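/- **The 6/4 mailbox algorithm.** Two serial processes, a postman and a homeowner, share registers $D_{num}\in\mathbb N$, $T_P\in\{0,1\}$, $F_P\in\{0,1,2\}$ (written by the postman; initially $0,0,2$), registers $R_{num}\in\mathbb N$, $T_H\in\{0,1\}$, $F_H\in\{\text{true},\text{false}\}$ (written by the homeowner; initially $0,0,\text{false}$), and an initially empty FIFO queue $Q$ of letters. The local variable $dn$ of the postman and the local variable $rn$ of the homeowner are initially $0$; other local variables have arbitrary initial values. (Local variables of the two processes are different even if they have the same name.) The operations are * $\mathrm{deliver}(\ell)$, executed by the postman: (1) add $\ell$ to $Q$; (2) $dn:=dn+1$; $D_{num}:=dn$; (3) $t:=T_H$; (4) $T_P:=1-t$; (5) $rn:=R_{num}$; (6) if $rn<dn$ then $F_P:=1-t$ else $F_P:=2$. * $\mathrm{check}()$, executed by the homeowner: (1) $fh:=F_H$; if $fh$ return true; (2) $th:=T_H$; (3) $tp:=T_P$; (4) $fp:=F_P$; (5) return the truth value of ($tp\neq th$ and $fp=tp$). * $\mathrm{remove}()$, executed by the homeowner: (1) remove one letter from $Q$; (2) $rn:=rn+1$; $R_{num}:=rn$; (3) $t:=T_P$;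 (4) $T_H:=t$; (5) $dn:=D_{num}$; (6) $F_H:=$ the truth value of $rn<dn$. The postman repeatedly executes $\mathrm{deliver}$, with arbitrary letters. The homeowner repeats: execute $\mathrm{check}$ until it returns true, then execute $\mathrm{remove}$ once. **Executions.** An execution is a finite or infinite sequence of atomic actions (single reads or writes of a register, and single queue actions; removing a letter from an empty queue would yield no letter) obtained by interleaving the two processes, where each read of a register returns the value of the last preceding write on it (or the initial value), and where every operation that is begun is completed. An operation execution is identified with its set of actions. For operation executions $X,Y$ write $X<Y$ if every action of $X$ precedes every action of $Y$. For a deliver operation $D$ let $dn(D)$ be the value that it assigns to $dn$; for a check operation $C$ let $rn(C)$ be the number of remove operations $R$ with $R<C$. Call $C$ positive if it returns true and negative if it returns false. Let $\lhd$ be the relation consisting of the pairs $(C,D)$ with $C$ a negative check, $D$ a deliver operation and $rn(C)<dn(D)$, and of the pairs $(D,C)$ with $C$ a positive check, $D$ a deliver operation and $dn(D)=rn(C)+1$. Let ${<^*}={<}\cup{\lhd}$. **Theorem.** For every execution of the 6/4 mailbox algorithm, every strict total order $\prec$ on its operation executions that extends $<^*$ satisfies the linear mailbox specification: 1. The operation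 executions are partitioned into deliver, check and remove operations, and are totally ordered by $\prec$, in the order type of the natural numbers if there are infinitely many. 2. For every remove operation $R$ there is a positive check operation $C\prec R$ such that no check or remove operation $X$ satisfies $C\prec X\prec R$. 3. A check operation $C$ returns true if and only if the number of remove operations $R\prec C$ is smaller than the number of deliver operations $D\prec C$ (and otherwise returns false). 4. If $D_1\prec D_2\prec\cdots$ and $R_1\prec R_2\prec\cdots$ enumerate the deliver and the remove operations, then for every $i$ such that $R_i$ exists, $D_i$ exists and $R_i$ removes a letter, namely the letter delivered by $D_i$. -/

import Mathlib

namespace Mailbox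

universe u

/-! ### The algorithm as a transition system -/

/-- The two serial processes. -/
inductive Proc
  | postman
  | homeowner

/-- Program counter of the postman: the line of `deliver` whose action is executed next.
At `d1` the postman is between two operations. -/
inductive PostmanPC
  | d1 | d2 | d3 | d4 | d5 | d6

/-- Program counter of the homeowner: the line of `check` (`c1`, ..., `c4`) or of `remove`
(`r1`, ..., `r6`) whose action is executed next.  At `c1` and at `r1` the homeowner is between
two operations.  (Line 5 of `check` only involves local variables; it is executed together with
the read of line 4.) -/
inductive HomeownerPC
  | c1 | c2 | c3 | c4
  | r1 | r2 | r3 | r4 | r5 | r6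

/-- A global state: the shared registers, the queue, and the local variables and program counters
of both processes; `L` is the type of letters.  A register holds the value last written on it,
so a read returns the value of the last preceding write. -/
structure State (L : Type u) where
  /-- register `D_num` of the postman -/
  Dnum : ℕ
  /-- register `T_P` of the postman -/
  TP : Fin 2
  /-- register `F_P` of the postman -/
  FP : Fin 3
  /-- register `R_num` of the homeowner -/
  Rnum : ℕ
  /-- register `T_H` of the homeowner -/
  TH : Fin 2
  /-- register `F_H` of the homeowner -/
  FH : Bool
  /-- the queue `Q`, front first -/
  queue : List L
  /-- postman: program counter -/
  ppc : PostmanPC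
  /-- postman: the parameter of the latest invocation of `deliver` -/
  letter : Option L
  /-- postman: local variable `dn` -/
  pdn : ℕ
  /-- postman: local variable `rn` -/
  prn : ℕ
  /-- postman: local variable `t` -/
  pt : Fin 2
  /-- homeowner: program counter -/
  hpc : HomeownerPC
  /-- homeowner: the variable `v` receiving the value returned by `check` -/
  v : Bool
  /-- homeowner, `check`: local variable `fh` -/
  fh : Bool
  /-- homeowner, `check`: local variable `th` -/
  th : Fin 2
  /-- homeowner, `check`: local variable `tp` -/
  tp : Fin 2
  /-- homeowner, `check`: local variable `fp` -/
  fp : Fin 3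
  /-- homeowner, `remove`: the result of the latest dequeue (`none` if the queue was empty) -/
  removed : Option L
  /-- homeowner, `remove`: local variable `rn` -/
  hrn : ℕ
  /-- homeowner, `remove`: local variable `dn` -/
  hdn : ℕ
  /-- homeowner, `remove`: local variable `t` -/
  ht : Fin 2

variable {L : Type u}

/-- Initial states.  Variables that are not mentioned may have any initial value. -/
structure State.Initial (s : State L) : Prop where
  Dnum : s.Dnum = 0
  TP : s.TP = 0
  FP : s.FP = 2
  Rnum : s.Rnum = 0
  TH : s.TH = 0
  FH : s.FH = false
  queue : s.queue = []
  ppc : s.ppc = PostmanPC.d1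
  pdn : s.pdn = 0
  hpc : s.hpc = HomeownerPC.c1
  hrn : s.hrn = 0

/-- The process is not in the middle of an operation. -/
def State.Between (s : State L) : Proc → Prop
  | Proc.postman => s.ppc = PostmanPC.d1
  | Proc.homeowner => s.hpc = HomeownerPC.c1 ∨ s.hpc = HomeownerPC.r1

/-- `Step p s t`: an atomic action of process `p` (one read or write of a register, or one queue
action, together with the adjacent computation on local variables) leads from `s` to `t`. -/
inductive Step : Proc → State L → State L → Prop
  -- deliver(letter)
  -- 1: add letter to Q
  | deliver1 (s : State L) (l : L) (h : s.ppc = PostmanPC.d1) :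
      Step Proc.postman s
        { s with letter := some l, queue := s.queue ++ [l], ppc := PostmanPC.d2 }
  -- 2: dn := dn + 1; D_num := dn
  | deliver2 (s : State L) (h : s.ppc = PostmanPC.d2) :
      Step Proc.postman s
        { s with pdn := s.pdn + 1, Dnum := s.pdn + 1, ppc := PostmanPC.d3 }
  -- 3: t := T_H
  | deliver3 (s : State L) (h : s.ppc = PostmanPC.d3) :
      Step Proc.postman s { s with pt := s.TH, ppc := PostmanPC.d4 }
  -- 4: T_P := 1 - t
  | deliver4 (s : State L) (h : s.ppc = PostmanPC.d4) :
      Step Proc.postman s { s with TP := 1 - s.pt, ppc := PostmanPC.d5 }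
  -- 5: rn := R_num
  | deliver5 (s : State L) (h : s.ppc = PostmanPC.d5) :
      Step Proc.postman s { s with prn := s.Rnum, ppc := PostmanPC.d6 }
  -- 6: if rn < dn then F_P := 1 - t else F_P := 2
  | deliver6 (s : State L) (h : s.ppc = PostmanPC.d6) :
      Step Proc.postman s
        { s with FP := if s.prn < s.pdn then (1 - s.pt).castSucc else 2, ppc := PostmanPC.d1 }
  -- check()
  -- 1: fh := F_H; if fh then return true
  | check1_short (s : State L) (h : s.hpc = HomeownerPC.c1) (hF : s.FH = true) :
      Step Proc.homeowner s { s with fh := s.FH, v := true, hpc := HomeownerPC.r1 }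
  | check1_long (s : State L) (h : s.hpc = HomeownerPC.c1) (hF : s.FH = false) :
      Step Proc.homeowner s { s with fh := s.FH, hpc := HomeownerPC.c2 }
  -- 2: th := T_H
  | check2 (s : State L) (h : s.hpc = HomeownerPC.c2) :
      Step Proc.homeowner s { s with th := s.TH, hpc := HomeownerPC.c3 }
  -- 3: tp := T_P
  | check3 (s : State L) (h : s.hpc = HomeownerPC.c3) :
      Step Proc.homeowner s { s with tp := s.TP, hpc := HomeownerPC.c4 }
  -- 4: fp := F_P; 5: return (tp ≠ th ∧ fp = tp);
  -- `remove` is invoked next if true is returned, and `check` otherwise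
  | check4_true (s : State L) (h : s.hpc = HomeownerPC.c4)
      (hv : s.tp ≠ s.th ∧ s.FP = s.tp.castSucc) :
      Step Proc.homeowner s { s with fp := s.FP, v := true, hpc := HomeownerPC.r1 }
  | check4_false (s : State L) (h : s.hpc = HomeownerPC.c4)
      (hv : ¬ (s.tp ≠ s.th ∧ s.FP = s.tp.castSucc)) :
      Step Proc.homeowner s { s with fp := s.FP, v := false, hpc := HomeownerPC.c1 }
  -- remove()
  -- 1: remove one letter from Q
  | remove1 (s : State L) (h : s.hpc = HomeownerPC.r1) :
      Step Proc.homeowner s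
        { s with removed := s.queue.head?, queue := s.queue.tail, hpc := HomeownerPC.r2 }
  -- 2: rn := rn + 1; R_num := rn
  | remove2 (s : State L) (h : s.hpc = HomeownerPC.r2) :
      Step Proc.homeowner s
        { s with hrn := s.hrn + 1, Rnum := s.hrn + 1, hpc := HomeownerPC.r3 }
  -- 3: t := T_P
  | remove3 (s : State L) (h : s.hpc = HomeownerPC.r3) :
      Step Proc.homeowner s { s with ht := s.TP, hpc := HomeownerPC.r4 }
  -- 4: T_H := t
  | remove4 (s : State L) (h : s.hpc = HomeownerPC.r4) :
      Step Proc.homeowner s { s with TH := s.ht, hpc := HomeownerPC.r5 }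
  -- 5: dn := D_num
  | remove5 (s : State L) (h : s.hpc = HomeownerPC.r5) :
      Step Proc.homeowner s { s with hdn := s.Dnum, hpc := HomeownerPC.r6 }
  -- 6: F_H := "rn < dn"
  | remove6 (s : State L) (h : s.hpc = HomeownerPC.r6) :
      Step Proc.homeowner s { s with FH := decide (s.hrn < s.hdn), hpc := HomeownerPC.c1 }

variable (L) in
/-- A finite or infinite run: an interleaving of the actions of the two processes.  The actions
are numbered by the `i` with `i < len`, in their total order; action `i` is executed by `proc i`
and leads from `state i` to `state (i + 1)`. -/
structure Run where
  len : ℕ∞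
  state : ℕ → State L
  proc : ℕ → Proc
  initial : (state 0).Initial
  step : ∀ i : ℕ, (i : ℕ∞) < len → Step (proc i) (state i) (state (i + 1))

/-! ### Operation executions -/

/-- A (completed) operation execution in a run: it begins with action `first` and ends with action
`last` of one process, which is between two operations before `first` and after `last`, but at no
time in the meantime. -/
structure OpExec (r : Run L) where
  first : ℕ
  last : ℕ
  first_le_last : first ≤ last
  last_lt : (last : ℕ∞) < r.len
  same_proc : r.proc last = r.proc first
  begins : (r.state first).Between (r.proc first)
  ends : (r.state (last + 1)).Between (r.proc first)
  inside : ∀ k, first < k → k ≤ last → ¬ (r.state k).Between (r.proc first)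

namespace OpExec

variable {r : Run L}

/-- The actions that an operation execution consists of. -/
def actions (X : OpExec r) : Set ℕ :=
  {i | X.first ≤ i ∧ i ≤ X.last ∧ r.proc i = r.proc X.first}

def IsDeliver (X : OpExec r) : Prop :=
  r.proc X.first = Proc.postman

def IsCheck (X : OpExec r) : Prop :=
  r.proc X.first = Proc.homeowner ∧ (r.state X.first).hpc = HomeownerPC.c1

def IsRemove (X : OpExec r) : Prop :=
  r.proc X.first = Proc.homeowner ∧ (r.state X.first).hpc = HomeownerPC.r1

/-- The value returned by a check operation. -/
def val (C : OpExec r) : Bool := (r.state (C.last + 1)).v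

/-- The letter delivered by a deliver operation. -/
def delivered (D : OpExec r) : Option L := (r.state (D.last + 1)).letter

/-- The letter obtained by a remove operation; `none` if the queue was found empty. -/
def removed (R : OpExec r) : Option L := (r.state (R.last + 1)).removed

/-- The delivery number `dn(D)`: the value that `D` assigns to the postman's variable `dn`. -/
def dn (D : OpExec r) : ℕ := (r.state (D.last + 1)).pdn

/-- The precedence relation `X < Y`: every action of `X` precedes every action of `Y`. -/
def Precedes (X Y : OpExec r) : Prop :=
  ∀ a ∈ X.actions, ∀ b ∈ Y.actions, a < b

/-- `rn(C)`: the number of remove operations `R` with `R < C`. -/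
noncomputable def rn (C : OpExec r) : ℕ∞ :=
  {R : OpExec r | R.IsRemove ∧ R.Precedes C}.encard

/-- The relation `X ◁ Y`. -/
def Tri (X Y : OpExec r) : Prop :=
  (X.IsCheck ∧ Y.IsDeliver ∧ X.val = false ∧ X.rn < (Y.dn : ℕ∞)) ∨
  (X.IsDeliver ∧ Y.IsCheck ∧ Y.val = true ∧ (X.dn : ℕ∞) = Y.rn + 1)

/-- The relation `<*`, the union of `<` and `◁`. -/
def StarLT (X Y : OpExec r) : Prop :=
  X.Precedes Y ∨ X.Tri Y

end OpExec

/-- Every operation that is begun is completed: each action of the run belongs to a (completed)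
operation execution. -/
def Run.Complete (r : Run L) : Prop :=
  ∀ i : ℕ, (i : ℕ∞) < r.len → ∃ X : OpExec r, i ∈ X.actions

/-! ### The linear mailbox specification -/

/-- In the ordering `prec`, the event `X` is the `i`-th event with property `P`, counting
from `0`. -/
def IsNth {E : Type*} (prec : E → E → Prop) (P : E → Prop) (i : ℕ) (X : E) : Prop :=
  P X ∧ {Y | P Y ∧ prec Y X}.encard = i

/-- The linear mailbox specification, for events of three kinds ordered by `prec`. -/
structure LinearMailbox {E : Type*} {M : Type*} (IsDeliver IsCheck IsRemove : E → Prop)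
    (val : E → Bool) (delivered removed : E → Option M) (prec : E → E → Prop) : Prop where
  /-- The events are partitioned into deliver, check and remove events. -/
  partition : ∀ X, (IsDeliver X ∧ ¬ IsCheck X ∧ ¬ IsRemove X) ∨
    (¬ IsDeliver X ∧ IsCheck X ∧ ¬ IsRemove X) ∨ (¬ IsDeliver X ∧ ¬ IsCheck X ∧ IsRemove X)
  /-- The events are totally ordered ... -/
  total : IsStrictTotalOrder E prec
  /-- ... in the order type of the natural numbers, if there are infinitely many. -/
  orderType : Finite E ∨ Nonempty (prec ≃r ((· < ·) : ℕ → ℕ → Prop))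
  /-- Each remove comes right after a positive check among the check and remove events. -/
  remove_after_check : ∀ R, IsRemove R → ∃ C, IsCheck C ∧ val C = true ∧ prec C R ∧
    ¬ ∃ X, (IsCheck X ∨ IsRemove X) ∧ prec C X ∧ prec X R
  /-- A check is positive iff it is preceded by more deliver than remove events. -/
  check_iff : ∀ C, IsCheck C →
    (val C = true ↔
      {R | IsRemove R ∧ prec R C}.encard < {D | IsDeliver D ∧ prec D C}.encard)
  /-- The `i`-th remove event obtains the letter of the `i`-th deliver event. -/
  fifo : ∀ (i : ℕ) (R : E), IsNth prec IsRemove i R →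
    ∃ D, IsNth prec IsDeliver i D ∧ ∃ l, delivered D = some l ∧ removed R = some l

end Mailbox

namespace Mailbox

universe u

variable {L : Type u}

/-! ### The safety invariant -/

/-! The heart is safety: when the homeowner is about to remove, fewer removals than deliveries have
been counted, so the queue is nonempty (`Step.inv`, `State.Inv.deq_lt_enq`). A short positive check
relies on `F_H`, computed from a comparison that later deliveries cannot falsify. A long positive
check relies on the handshake. Suppose `pdn ≤ hrn` and `F_P` still holds some `x : Fin 2`. Once
`remove` has written `T_H`, either `T_H = x`, or the postman is at `d5` or `d6` with `T_P = T_H`.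
Hence no check can find both `tp ≠ th` and `fp = tp`.

Within one process, precedence is already total, so every admissible `prec` yields the same counts
of removes before a homeowner operation and of delivers before a deliver (`prec_iff`). Only the
position of checks relative to delivers is left open, and `◁` settles it. After a positive check,
safety supplies the deliver numbered `rn(C) + 1`, which `◁` places before the check together with
all earlier delivers. If the check is negative, `◁` keeps every deliver numbered above `rn(C)`
behind it.

FIFO order follows because the queue is a suffix of the history of all added letters (`Run.hist`).
The order type is that of the natural numbers because each operation has only finitely many
predecessors. -/

/-- The inductive invariant behind the handshake on `T_P`, `T_H` and `F_P`. -/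
structure State.Inv (s : State L) : Prop where
  Dnum : s.Dnum = s.pdn
  Rnum : s.Rnum = s.hrn
  TP : s.ppc = .d5 ∨ s.ppc = .d6 → s.TP = 1 - s.pt
  FP_TP : s.ppc ≠ .d5 → s.ppc ≠ .d6 → ∀ x : Fin 2, s.FP = x.castSucc → s.TP = x
  safe : s.hpc = .r1 ∨ s.hpc = .r2 → s.hrn < s.pdn
  FH : s.hpc = .c1 ∨ s.hpc = .c2 ∨ s.hpc = .c3 ∨ s.hpc = .c4 → s.FH = true → s.hrn < s.pdn
  hdn : s.hpc = .r6 → s.hdn ≤ s.pdn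
  th : s.hpc = .c3 ∨ s.hpc = .c4 → s.th = s.TH
  fresh_ht : s.ppc = .d6 → s.prn < s.pdn → s.pdn ≤ s.hrn → s.hpc = .r4 → s.ht = s.TP
  fresh_TH : s.ppc = .d6 → s.prn < s.pdn → s.pdn ≤ s.hrn →
    s.hpc ≠ .r1 → s.hpc ≠ .r2 → s.hpc ≠ .r3 → s.hpc ≠ .r4 → s.TH = s.TP
  FP_ht : ∀ x : Fin 2, s.FP = x.castSucc → s.pdn ≤ s.hrn → s.hpc = .r4 →
    s.ht = x ∨ ((s.ppc = .d5 ∨ s.ppc = .d6) ∧ s.TP = s.ht)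
  FP_TH : ∀ x : Fin 2, s.FP = x.castSucc → s.pdn ≤ s.hrn →
    s.hpc ≠ .r1 → s.hpc ≠ .r2 → s.hpc ≠ .r3 → s.hpc ≠ .r4 →
    s.TH = x ∨ ((s.ppc = .d5 ∨ s.ppc = .d6) ∧ s.TP = s.TH)
  FP_tp : ∀ x : Fin 2, s.FP = x.castSucc → s.pdn ≤ s.hrn → s.hpc = .c4 →
    s.TH = x ∨ s.tp = s.TH

theorem State.Initial.inv {s : State L} (h : s.Initial) : s.Inv := by
  obtain ⟨h1, h2, h3, h4, h5, h6, h7, h8, h9, h10, h11⟩ := h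
  constructor <;> simp_all

-- The critical case is `check4_true`: if `pdn ≤ hrn`, then `FP_tp` with `x = tp` gives `TH = tp`,
-- contradicting `tp ≠ th = TH`. At `deliver6`, the `fresh` clauses re-establish the clauses on
-- `FP`; at `remove3` it is `TP` or `FP_TP`, according to the postman's position.
set_option maxHeartbeats 1000000 in
theorem Step.inv {p : Proc} {s t : State L} (h : Step p s t) (hs : s.Inv) : t.Inv := by
  obtain ⟨i1, i2, i3, i4, i5, i6, i7, i8, i9, i10, i11, i12, i13⟩ := hs
  cases h <;> constructor <;> first | assumption | grind -ring -order -ac -linarith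

/-! ### Counting the operations begun -/

/-- The number of letters added to the queue so far. -/
def State.enq (s : State L) : ℕ := s.pdn + match s.ppc with | .d2 => 1 | _ => 0

/-- The number of letters removed from the queue so far. -/
def State.deq (s : State L) : ℕ := s.hrn + match s.hpc with | .r2 => 1 | _ => 0

/-- The homeowner is executing, or about to execute, `remove`. -/
def State.Removing (s : State L) : Prop :=
  s.hpc = .r1 ∨ s.hpc = .r2 ∨ s.hpc = .r3 ∨ s.hpc = .r4 ∨ s.hpc = .r5 ∨ s.hpc = .r6

theorem State.pdn_le_enq (s : State L) : s.pdn ≤ s.enq := Nat.le_add_right _ _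

theorem State.enq_of_between {s : State L} (h : s.Between .postman) : s.enq = s.pdn := by
  simp_all [State.enq, State.Between]

theorem State.deq_of_between {s : State L} (h : s.Between .homeowner) : s.deq = s.hrn := by
  rcases h with h | h <;> simp [State.deq, h]

/-- The letter enters the queue before `pdn` is incremented, so `enq` can only exceed `pdn`. -/
theorem State.Inv.deq_lt_enq {s : State L} (hs : s.Inv) (h : s.hpc = .r1) : s.deq < s.enq := by
  rw [State.deq_of_between (Or.inr h)]
  exact (hs.safe (Or.inl h)).trans_le s.pdn_le_enq

theorem Step.hpc_eq {s t : State L} (h : Step .postman s t) : t.hpc = s.hpc := by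
  cases h <;> rfl

theorem Step.enq_deliver {s t : State L} (h : Step .postman s t) (hs : s.ppc = .d1) :
    t.enq = s.enq + 1 := by
  cases h <;> simp_all [State.enq]

theorem Step.enq_eq {p : Proc} {s t : State L} (h : Step p s t)
    (hs : ¬ (p = .postman ∧ s.ppc = .d1)) : t.enq = s.enq := by
  cases h <;> simp_all [State.enq]

theorem Step.deq_remove {s t : State L} (h : Step .homeowner s t) (hs : s.hpc = .r1) :
    t.deq = s.deq + 1 := by
  cases h <;> simp_all [State.deq]

theorem Step.deq_eq {p : Proc} {s t : State L} (h : Step p s t)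
    (hs : ¬ (p = .homeowner ∧ s.hpc = .r1)) : t.deq = s.deq := by
  cases h <;> simp_all [State.deq]

/-- This keeps the kind of a homeowner operation constant from its first action to its last. -/
theorem Step.removing_iff {p : Proc} {s t : State L} (h : Step p s t)
    (ht : ¬ t.Between .homeowner) : t.Removing ↔ s.Removing := by
  cases h <;> simp_all [State.Removing, State.Between]

theorem Step.hpc_of_v {s t : State L} (h : Step .homeowner s t) (hs : ¬ s.Removing)
    (ht : t.Between .homeowner) (hv : t.v = true) : t.hpc = .r1 := by
  cases h <;> simp_all [State.Removing, State.Between]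

theorem Step.of_hpc {s t : State L} (h : Step .homeowner s t) (ht : t.hpc = .r1) :
    ¬ s.Removing ∧ t.v = true := by
  cases h <;> simp_all [State.Removing]

/-! ### Invariants along a run -/

namespace Run

variable (r : Run L)

theorem induction_le {P : ℕ → Prop} (h0 : P 0)
    (hs : ∀ k : ℕ, (k : ℕ∞) < r.len → P k → P (k + 1)) (k : ℕ) (hk : (k : ℕ∞) ≤ r.len) : P k := by
  induction k with
  | zero => exact h0
  | succ k ih =>
    have : (k : ℕ∞) < r.len := lt_of_lt_of_le (by exact_mod_cast Nat.lt_succ_self k) hk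
    exact hs k this (ih this.le)

theorem inv (k : ℕ) (hk : (k : ℕ∞) ≤ r.len) : (r.state k).Inv :=
  r.induction_le (P := fun k => (r.state k).Inv) r.initial.inv
    (fun k hk ih => (r.step k hk).inv ih) k hk

/-- Action `k` begins a deliver operation. -/
def Delivers (k : ℕ) : Prop := r.proc k = .postman ∧ (r.state k).ppc = .d1

/-- Action `k` begins a remove operation. -/
def Removes (k : ℕ) : Prop := r.proc k = .homeowner ∧ (r.state k).hpc = .r1

theorem enq_zero : (r.state 0).enq = 0 := by
  simp [State.enq, r.initial.ppc, r.initial.pdn]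

theorem deq_zero : (r.state 0).deq = 0 := by
  simp [State.deq, r.initial.hpc, r.initial.hrn]

variable {r}

theorem enq_succ {k : ℕ} (hk : (k : ℕ∞) < r.len) (h : r.Delivers k) :
    (r.state (k + 1)).enq = (r.state k).enq + 1 := by
  have := r.step k hk
  rw [h.1] at this
  exact this.enq_deliver h.2

theorem deq_succ {k : ℕ} (hk : (k : ℕ∞) < r.len) (h : r.Removes k) :
    (r.state (k + 1)).deq = (r.state k).deq + 1 := by
  have := r.step k hk
  rw [h.1] at this
  exact this.deq_remove h.2

/-! ### The queue as a suffix of the letter history -/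

open Classical in
variable (r) in
/-- The letters added to the queue before action `k`. -/
noncomputable def history : ℕ → List L
  | 0 => []
  | k + 1 => if r.Delivers k then history k ++ (r.state (k + 1)).letter.toList else history k

theorem history_prefix {j k : ℕ} (h : j ≤ k) : r.history j <+: r.history k := by
  induction k, h using Nat.le_induction with
  | base => exact List.prefix_refl _
  | succ k _ ih =>
    refine ih.trans ?_
    rw [history]
    split
    · exact List.prefix_append _ _
    · exact List.prefix_refl _

end Run

/-- The relation of a state to the sequence of all letters added to the queue so far. -/
structure State.Hist (s : State L) (l : List L) : Prop where
  length : l.length = s.enq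
  deq_le : s.deq ≤ s.enq
  queue : s.queue = l.drop s.deq
  -- Before the first delivery or removal these variables hold arbitrary initial values.
  letter : s.enq ≠ 0 → s.letter = l[s.enq - 1]?
  removed : s.deq ≠ 0 → s.removed = l[s.deq - 1]?

theorem Step.hist_deliver {s t : State L} {l : List L} (h : Step .postman s t)
    (hs : s.Hist l) (hp : s.ppc = .d1) : t.Hist (l ++ t.letter.toList) := by
  have he := h.enq_deliver hp
  have hd := h.deq_eq (by simp)
  obtain ⟨h1, h2, h3, h4, h5⟩ := hs
  cases h <;> simp_all only [reduceCtorEq]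
  constructor
  · simp [he, h1]
  · omega
  · simp only [hd, Option.toList_some]
    rw [List.drop_append_of_le_length (by omega)]
  · intro _
    simp [he, ← h1]
  · intro h0
    simp only [hd] at h0 ⊢
    rw [h5 h0, List.getElem?_append_left (by omega)]

theorem Step.hist_remove {s t : State L} {l : List L} (h : Step .homeowner s t)
    (hs : s.Hist l) (hi : s.Inv) (hp : s.hpc = .r1) : t.Hist l := by
  have he := h.enq_eq (by simp)
  have hd := h.deq_remove hp
  have hlt := hi.deq_lt_enq hp
  have hq : t.queue = s.queue.tail := by cases h <;> simp_all
  have hl : t.letter = s.letter := by cases h <;> simp_all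
  have hr : t.removed = s.queue.head? := by cases h <;> simp_all
  obtain ⟨h1, h2, h3, h4, h5⟩ := hs
  constructor
  · rw [he, h1]
  · omega
  · rw [hd, hq, h3, List.tail_drop]
  · rwa [he, hl]
  · rw [hd, hr, h3, List.head?_drop]
    exact fun _ => rfl

theorem Step.hist_other {p : Proc} {s t : State L} {l : List L} (h : Step p s t)
    (hs : s.Hist l) (hp : ¬ (p = .postman ∧ s.ppc = .d1)) (hh : ¬ (p = .homeowner ∧ s.hpc = .r1)) :
    t.Hist l := by
  have he := h.enq_eq hp
  have hd := h.deq_eq hh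
  obtain ⟨h1, h2, h3, h4, h5⟩ := hs
  constructor
  · rw [he, h1]
  · rwa [he, hd]
  · rw [hd, ← h3]
    cases h <;> simp_all
  · rw [he, ← h1]
    intro h0
    rw [h1, ← h4 (h1 ▸ h0)]
    cases h <;> simp_all
  · rw [hd]
    intro h0
    rw [← h5 h0]
    cases h <;> simp_all

namespace Run

variable (r : Run L)

theorem hist (k : ℕ) (hk : (k : ℕ∞) ≤ r.len) : (r.state k).Hist (r.history k) := by
  refine r.induction_le (P := fun k => (r.state k).Hist (r.history k)) ?_ ?_ k hk
  · have h0 := r.enq_zero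
    have h1 := r.deq_zero
    constructor <;> simp [h0, h1, r.initial.queue, history]
  · intro k hk ih
    have hstep := r.step k hk
    rw [history]
    split
    next h => rw [h.1] at hstep; exact hstep.hist_deliver ih h.2
    next h =>
      by_cases h' : r.Removes k
      · rw [h'.1] at hstep; exact hstep.hist_remove ih (r.inv k hk.le) h'.2
      · exact hstep.hist_other ih h h'

end Run

/-! ### Operation executions -/

namespace OpExec

variable {r : Run L}

theorem first_mem (X : OpExec r) : X.first ∈ X.actions := ⟨le_rfl, X.first_le_last, rfl⟩

theorem last_mem (X : OpExec r) : X.last ∈ X.actions := ⟨X.first_le_last, le_rfl, X.same_proc⟩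

theorem precedes_iff {X Y : OpExec r} : X.Precedes Y ↔ X.last < Y.first :=
  ⟨fun h => h _ X.last_mem _ Y.first_mem, fun h _ ha _ hb => (ha.2.1.trans_lt h).trans_le hb.1⟩

theorem first_lt_len (X : OpExec r) : (X.first : ℕ∞) < r.len :=
  lt_of_le_of_lt (by exact_mod_cast X.first_le_last) X.last_lt

theorem last_succ_le (X : OpExec r) : ((X.last + 1 : ℕ) : ℕ∞) ≤ r.len := by
  push_cast
  exact Order.add_one_le_of_lt X.last_lt

theorem lt_len_of_le_last (X : OpExec r) {k : ℕ} (h : k ≤ X.last) : (k : ℕ∞) < r.len :=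
  lt_of_le_of_lt (by exact_mod_cast h) X.last_lt

theorem last_lt_of_first_lt {X Y : OpExec r} (hp : r.proc X.first = r.proc Y.first)
    (h : X.first < Y.first) : X.last < Y.first := by
  by_contra! hle
  exact X.inside _ h hle (hp ▸ Y.begins)

/-- An operation ends at the first later moment at which its process is between operations, so its
first action determines it. -/
theorem eq_of_first_eq {X Y : OpExec r} (h : X.first = Y.first) : X = Y := by
  have key : ∀ {X Y : OpExec r}, X.first = Y.first → Y.last ≤ X.last := by
    intro X Y h
    by_contra! hlt
    exact Y.inside _ (by have := X.first_le_last; omega) hlt (h ▸ X.ends)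
  have hl := le_antisymm (key h.symm) (key h)
  cases X; cases Y; simp_all

theorem first_injective : Function.Injective (first : OpExec r → ℕ) :=
  fun _ _ => eq_of_first_eq

theorem first_eq_of_mem {X : OpExec r} {k : ℕ} (hk : k ∈ X.actions)
    (h : (r.state k).Between (r.proc k)) : X.first = k := by
  by_contra hne
  exact X.inside k (lt_of_le_of_ne hk.1 hne) hk.2.1 (hk.2.2 ▸ h)

theorem last_eq_of_mem {X : OpExec r} {k : ℕ} (hk : k ∈ X.actions)
    (h : (r.state (k + 1)).Between (r.proc k)) : X.last = k := by
  by_contra hne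
  have := hk.2.1
  exact X.inside (k + 1) (Nat.lt_succ_of_le hk.1) (by omega) (hk.2.2 ▸ h)

theorem isDeliver_iff {X : OpExec r} : X.IsDeliver ↔ r.Delivers X.first := by
  refine ⟨fun h => ⟨h, ?_⟩, fun h => h.1⟩
  have := X.begins
  rwa [show r.proc X.first = .postman from h] at this

theorem isRemove_iff {X : OpExec r} : X.IsRemove ↔ r.Removes X.first := Iff.rfl

theorem exists_first_eq (hr : r.Complete) {k : ℕ} (hk : (k : ℕ∞) < r.len)
    (h : (r.state k).Between (r.proc k)) : ∃ X : OpExec r, X.first = k :=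
  let ⟨X, hX⟩ := hr k hk
  ⟨X, first_eq_of_mem hX h⟩

theorem not_between_of_mem {X : OpExec r} {k : ℕ} (h1 : X.first < k) (h2 : k ≤ X.last) :
    ¬ (r.proc k = r.proc X.first ∧ (r.state k).Between (r.proc X.first)) :=
  fun h => X.inside k h1 h2 h.2

/-- A quantity that changes only when an operation of the process of `X` begins has, when `X`
ends, the value that it had after the first action of `X`. -/
theorem eq_last {α : Type*} {X : OpExec r} {f : ℕ → α}
    (hf : ∀ k : ℕ, (k : ℕ∞) < r.len →
      ¬ (r.proc k = r.proc X.first ∧ (r.state k).Between (r.proc X.first)) → f (k + 1) = f k) :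
    f (X.last + 1) = f (X.first + 1) := by
  have : ∀ k, X.first ≤ k → k ≤ X.last → f (k + 1) = f (X.first + 1) := by
    intro k hk
    induction k, hk using Nat.le_induction with
    | base => exact fun _ => rfl
    | succ k hk ih =>
      intro hle
      rw [hf _ (X.lt_len_of_le_last hle) (not_between_of_mem (by omega) hle), ih (by omega)]
  exact this _ X.first_le_last le_rfl

theorem enq_last {D : OpExec r} (h : D.IsDeliver) :
    (r.state (D.last + 1)).enq = (r.state D.first).enq + 1 := by
  rw [eq_last (f := fun k => (r.state k).enq), Run.enq_succ D.first_lt_len (isDeliver_iff.1 h)]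
  intro k hk hn
  refine (r.step k hk).enq_eq fun h' => hn ?_
  rw [show r.proc D.first = .postman from h]
  exact h'

theorem dn_eq {D : OpExec r} (h : D.IsDeliver) : D.dn = (r.state D.first).enq + 1 := by
  have := D.ends
  rw [show r.proc D.first = .postman from h] at this
  rw [← enq_last h, State.enq_of_between this, dn]

theorem deq_last {X : OpExec r} (h : r.proc X.first = .homeowner) :
    (r.state (X.last + 1)).deq = (r.state (X.first + 1)).deq := by
  refine eq_last (f := fun k => (r.state k).deq) fun k hk hn => ?_
  refine (r.step k hk).deq_eq fun h' => hn ?_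
  rw [h]
  exact ⟨h'.1, Or.inr h'.2⟩

theorem deq_last_remove {R : OpExec r} (h : R.IsRemove) :
    (r.state (R.last + 1)).deq = (r.state R.first).deq + 1 := by
  rw [deq_last h.1, Run.deq_succ R.first_lt_len h]

theorem deq_last_check {C : OpExec r} (h : C.IsCheck) :
    (r.state (C.last + 1)).deq = (r.state C.first).deq := by
  rw [deq_last h.1]
  exact (r.step _ C.first_lt_len).deq_eq fun h' => by simp [h.2] at h'

theorem removing_iff {X : OpExec r} (h : r.proc X.first = .homeowner) {k : ℕ}
    (hk : X.first ≤ k) (hl : k ≤ X.last) : (r.state k).Removing ↔ (r.state X.first).Removing := by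
  induction k, hk using Nat.le_induction with
  | base => rfl
  | succ k hk ih =>
    rw [← ih (by omega)]
    refine (r.step k (X.lt_len_of_le_last (by omega))).removing_iff ?_
    have := X.inside (k + 1) (by omega) hl
    rwa [h] at this

theorem IsCheck.not_removing {C : OpExec r} (h : C.IsCheck) : ¬ (r.state C.first).Removing := by
  simp [State.Removing, h.2]

theorem hpc_of_val {C : OpExec r} (h : C.IsCheck) (hv : C.val = true) :
    (r.state (C.last + 1)).hpc = .r1 := by
  have hs := r.step _ C.last_lt
  have he := C.ends
  rw [C.same_proc, h.1] at hs
  rw [h.1] at he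
  exact hs.hpc_of_v (by rw [removing_iff h.1 C.first_le_last le_rfl]; exact h.not_removing) he hv

/-! ### Counting operations -/

/-- A counter that is incremented by the actions that begin an operation with property `Q`, and
by no others, counts these operations. -/
theorem encard_eq_counter {Q : OpExec r → Prop} {P : ℕ → Prop} {f : ℕ → ℕ}
    (hQ : ∀ X, Q X ↔ P X.first)
    (hP : ∀ k : ℕ, (k : ℕ∞) < r.len → P k → ∃ X : OpExec r, X.first = k) (h0 : f 0 = 0)
    (h1 : ∀ k : ℕ, (k : ℕ∞) < r.len → P k → f (k + 1) = f k + 1)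
    (h2 : ∀ k : ℕ, (k : ℕ∞) < r.len → ¬ P k → f (k + 1) = f k)
    (k : ℕ) (hk : (k : ℕ∞) ≤ r.len) : {X | Q X ∧ X.first < k}.encard = f k := by
  refine r.induction_le (P := fun k => {X | Q X ∧ X.first < k}.encard = f k) ?_ ?_ k hk
  · simp [h0]
  · intro k hk ih
    by_cases hPk : P k
    · obtain ⟨X, rfl⟩ := hP k hk hPk
      have : {Y | Q Y ∧ Y.first < X.first + 1} = insert X {Y | Q Y ∧ Y.first < X.first} := by
        ext Y
        simp only [Set.mem_ofPred_eq, Set.mem_insert_iff, Nat.lt_succ_iff_lt_or_eq]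
        constructor
        · rintro ⟨hY, h | h⟩
          · exact Or.inr ⟨hY, h⟩
          · exact Or.inl (eq_of_first_eq h)
        · rintro (rfl | h)
          · exact ⟨(hQ _).2 hPk, Or.inr rfl⟩
          · exact ⟨h.1, Or.inl h.2⟩
      rw [this, Set.encard_insert_of_notMem (by simp), ih, h1 _ hk hPk]
      rfl
    · rw [h2 k hk hPk, ← ih]
      congr 1
      ext Y
      simp only [Set.mem_ofPred_eq, Nat.lt_succ_iff_lt_or_eq]
      refine and_congr_right fun hY => or_iff_left fun h => hPk ?_
      exact h ▸ (hQ Y).1 hY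

theorem encard_deliver (hr : r.Complete) (k : ℕ) (hk : (k : ℕ∞) ≤ r.len) :
    {D : OpExec r | D.IsDeliver ∧ D.first < k}.encard = (r.state k).enq :=
  encard_eq_counter (f := fun k => (r.state k).enq) (fun _ => isDeliver_iff)
    (fun _ hk h => exists_first_eq hr hk (h.1 ▸ h.2)) r.enq_zero
    (fun _ hk h => Run.enq_succ hk h) (fun _ hk h => (r.step _ hk).enq_eq h) k hk

theorem encard_remove (hr : r.Complete) (k : ℕ) (hk : (k : ℕ∞) ≤ r.len) :
    {R : OpExec r | R.IsRemove ∧ R.first < k}.encard = (r.state k).deq :=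
  encard_eq_counter (f := fun k => (r.state k).deq) (fun _ => isRemove_iff)
    (fun _ hk h => exists_first_eq hr hk (h.1 ▸ Or.inr h.2)) r.deq_zero
    (fun _ hk h => Run.deq_succ hk h) (fun _ hk h => (r.step _ hk).deq_eq h) k hk

/-- A discrete intermediate value argument: `enq` starts at 0 and rises by exactly one, only when a
deliver begins. -/
theorem exists_deliver_of_lt_enq (hr : r.Complete) {n k : ℕ} (hk : (k : ℕ∞) ≤ r.len)
    (hn : n < (r.state k).enq) :
    ∃ D : OpExec r, D.IsDeliver ∧ D.first < k ∧ (r.state D.first).enq = n := by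
  revert hn
  refine r.induction_le (P := fun k => n < (r.state k).enq →
    ∃ D : OpExec r, D.IsDeliver ∧ D.first < k ∧ (r.state D.first).enq = n) ?_ ?_ k hk
  · simp [r.enq_zero]
  · intro k hk ih hn
    by_cases hlt : n < (r.state k).enq
    · obtain ⟨D, h1, h2, h3⟩ := ih hlt
      exact ⟨D, h1, by omega, h3⟩
    · by_cases hd : r.Delivers k
      · obtain ⟨D, rfl⟩ := exists_first_eq hr hk (hd.1 ▸ hd.2)
        rw [Run.enq_succ hk hd] at hn
        exact ⟨D, isDeliver_iff.2 hd, by omega, by omega⟩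
      · rw [(r.step k hk).enq_eq hd] at hn
        exact absurd hn hlt

theorem dn_injOn (hr : r.Complete) : Set.InjOn dn {D : OpExec r | D.IsDeliver} := by
  intro D hD D' hD' h
  rw [dn_eq hD, dn_eq hD'] at h
  have key : ∀ {D D' : OpExec r}, D.IsDeliver → D.first < D'.first →
      (r.state D.first).enq ≠ (r.state D'.first).enq := by
    intro D D' hD hlt he
    have h1 := encard_deliver hr _ D.first_lt_len.le
    have h2 := encard_deliver hr _ D'.first_lt_len.le
    have hfin : {X : OpExec r | X.IsDeliver ∧ X.first < D.first}.Finite :=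
      Set.finite_of_encard_eq_coe h1
    -- The inclusion is strict because `D` itself lies in the larger set only; the two cardinalities
    -- are the values of `enq`.
    have hss : {X : OpExec r | X.IsDeliver ∧ X.first < D.first} ⊂
        {X : OpExec r | X.IsDeliver ∧ X.first < D'.first} :=
      ⟨fun X hX => ⟨hX.1, hX.2.trans hlt⟩, fun hs => lt_irrefl _ (hs ⟨hD, hlt⟩ : _ ∧ _).2⟩
    have := hfin.encard_lt_encard hss
    rw [h1, h2, he] at this
    exact lt_irrefl _ this
  rcases lt_trichotomy D.first D'.first with hlt | heq | hlt
  · exact absurd (Nat.succ_injective h) (key hD hlt)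
  · exact eq_of_first_eq heq
  · exact absurd (Nat.succ_injective h).symm (key hD' hlt)

/-! ### Linear orders extending precedence -/

variable {prec : OpExec r → OpExec r → Prop}

theorem prec_iff [IsStrictTotalOrder (OpExec r) prec]
    (hext : ∀ X Y : OpExec r, X.Precedes Y → prec X Y) {X Y : OpExec r}
    (hp : r.proc X.first = r.proc Y.first) : prec X Y ↔ X.first < Y.first := by
  have key : ∀ {X Y : OpExec r}, r.proc X.first = r.proc Y.first → X.first < Y.first → prec X Y :=
    fun hp h => hext _ _ (precedes_iff.2 (last_lt_of_first_lt hp h))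
  refine ⟨fun h => ?_, key hp⟩
  rcases lt_trichotomy X.first Y.first with hlt | heq | hlt
  · exact hlt
  · exact absurd (eq_of_first_eq heq ▸ h) (irrefl_of prec Y)
  · exact absurd h (asymm_of prec (key hp.symm hlt))

theorem precedes_iff_first_lt {X Y : OpExec r} (hp : r.proc X.first = r.proc Y.first) :
    X.Precedes Y ↔ X.first < Y.first :=
  ⟨fun h => X.first_le_last.trans_lt (precedes_iff.1 h),
    fun h => precedes_iff.2 (last_lt_of_first_lt hp h)⟩

/-- An operation beginning after `X` has ended follows `X`, so every predecessor begins no later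
than `X.last`. -/
theorem finite_prec [IsStrictTotalOrder (OpExec r) prec]
    (hext : ∀ X Y : OpExec r, X.Precedes Y → prec X Y) (X : OpExec r) : {Y | prec Y X}.Finite := by
  refine ((Set.finite_Iic X.last).preimage first_injective.injOn).subset fun Y hY => ?_
  by_contra hlt
  exact asymm_of prec hY (hext _ _ (precedes_iff.2 (not_le.1 hlt)))

/-! ### Counts in the linear order and the values of checks -/

theorem encard_remove_prec [IsStrictTotalOrder (OpExec r) prec] (hr : r.Complete)
    (hext : ∀ X Y : OpExec r, X.Precedes Y → prec X Y) {X : OpExec r}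
    (hX : r.proc X.first = .homeowner) :
    {R | R.IsRemove ∧ prec R X}.encard = (r.state X.first).deq := by
  rw [← encard_remove hr _ X.first_lt_len.le]
  congr 1
  ext R
  exact and_congr_right fun hR => prec_iff hext (hR.1.trans hX.symm)

theorem rn_eq (hr : r.Complete) {C : OpExec r} (hC : C.IsCheck) :
    C.rn = (r.state C.first).deq := by
  rw [← encard_remove hr _ C.first_lt_len.le, rn]
  congr 1
  ext R
  exact and_congr_right fun hR => precedes_iff_first_lt (hR.1.trans hC.1.symm)

theorem encard_deliver_prec [IsStrictTotalOrder (OpExec r) prec] (hr : r.Complete)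
    (hext : ∀ X Y : OpExec r, X.Precedes Y → prec X Y) {D : OpExec r} (hD : D.IsDeliver) :
    {X | X.IsDeliver ∧ prec X D}.encard = (r.state D.first).enq := by
  rw [← encard_deliver hr _ D.first_lt_len.le]
  congr 1
  ext X
  refine and_congr_right fun hX => prec_iff hext ?_
  exact Eq.trans hX (Eq.symm hD)

theorem encard_remove_lt_of_val [IsStrictTotalOrder (OpExec r) prec] (hr : r.Complete)
    (hext : ∀ X Y : OpExec r, X.StarLT Y → prec X Y) {C : OpExec r} (hC : C.IsCheck)
    (hv : C.val = true) :
    {R | R.IsRemove ∧ prec R C}.encard < {D | D.IsDeliver ∧ prec D C}.encard := by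
  have hext' : ∀ X Y : OpExec r, X.Precedes Y → prec X Y := fun X Y h => hext _ _ (Or.inl h)
  have hlt := (r.inv _ C.last_succ_le).deq_lt_enq (hpc_of_val hC hv)
  rw [deq_last_check hC] at hlt
  -- `D` has delivery number `rn(C) + 1`, so `D ◁ C`.
  obtain ⟨D, hD, -, hDn⟩ := exists_deliver_of_lt_enq hr C.last_succ_le hlt
  have hDC : prec D C := hext _ _ (Or.inr (Or.inr ⟨hD, hC, hv, by
    rw [rn_eq hr hC, dn_eq hD, hDn]; push_cast; rfl⟩))
  have hsub : insert D {X | X.IsDeliver ∧ prec X D} ⊆ {X | X.IsDeliver ∧ prec X C} := by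
    rintro X (rfl | hX)
    · exact ⟨hD, hDC⟩
    · exact ⟨hX.1, trans_of prec hX.2 hDC⟩
  have hcard := Set.encard_le_encard hsub
  rw [Set.encard_insert_of_notMem (fun h => irrefl_of prec D h.2),
    encard_deliver_prec hr hext' hD, hDn] at hcard
  rw [encard_remove_prec hr hext' hC.1]
  refine lt_of_lt_of_le ?_ hcard
  exact_mod_cast Nat.lt_succ_self _

theorem encard_deliver_le_of_val [IsStrictTotalOrder (OpExec r) prec] (hr : r.Complete)
    (hext : ∀ X Y : OpExec r, X.StarLT Y → prec X Y) {C : OpExec r} (hC : C.IsCheck)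
    (hv : C.val = false) :
    {D | D.IsDeliver ∧ prec D C}.encard ≤ {R | R.IsRemove ∧ prec R C}.encard := by
  rw [encard_remove_prec hr (fun X Y h => hext _ _ (Or.inl h)) hC.1]
  -- A deliver numbered above `rn(C)` would satisfy `C ◁ D`; the remaining numbers lie in an
  -- interval of `rn(C)` elements, and `dn` is injective.
  have hmaps : Set.MapsTo dn {D | D.IsDeliver ∧ prec D C}
      (Set.Icc 1 (r.state C.first).deq) := by
    intro D ⟨hD, hDC⟩
    refine ⟨by rw [dn_eq hD]; omega, ?_⟩
    by_contra! hlt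
    refine asymm_of prec hDC (hext _ _ (Or.inr (Or.inl ⟨hC, hD, hv, ?_⟩)))
    rw [rn_eq hr hC]
    exact_mod_cast hlt
  refine (Set.encard_le_encard_of_injOn hmaps
    ((dn_injOn hr).mono fun D h => h.1)).trans (le_of_eq ?_)
  rw [← Finset.coe_Icc, Set.encard_coe_eq_coe_finsetCard, Nat.card_Icc, Nat.add_sub_cancel]

/-! ### The check before a remove, and FIFO order -/

theorem exists_check_last_lt (hr : r.Complete) {R : OpExec r} (hR : R.IsRemove) :
    ∃ C : OpExec r, C.IsCheck ∧ C.val = true ∧ C.last < R.first ∧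
      ∀ i, C.last < i → i < R.first → r.proc i = .postman := by
  -- The postman never changes `hpc`, so the last homeowner action `j` before `R` left it at `r1`;
  -- that action ends a positive check.
  have key : (r.state R.first).hpc = .r1 → ∃ j < R.first, r.proc j = .homeowner ∧
      (r.state (j + 1)).hpc = .r1 ∧ ∀ i, j < i → i < R.first → r.proc i = .postman := by
    refine r.induction_le (P := fun k => (r.state k).hpc = .r1 → ∃ j < k, r.proc j = .homeowner ∧
      (r.state (j + 1)).hpc = .r1 ∧ ∀ i, j < i → i < k → r.proc i = .postman) ?_ ?_ _
      R.first_lt_len.le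
    · simp [r.initial.hpc]
    · intro k hk ih h
      rcases hp : r.proc k with _ | _
      · have hs := r.step k hk
        rw [hp] at hs
        obtain ⟨j, h1, h2, h3, h4⟩ := ih (hs.hpc_eq ▸ h)
        refine ⟨j, by omega, h2, h3, fun i hi hik => ?_⟩
        rcases Nat.lt_succ_iff_lt_or_eq.1 hik with hlt | rfl
        · exact h4 i hi hlt
        · exact hp
      · exact ⟨k, by omega, hp, h, fun i hi hik => by omega⟩
  obtain ⟨j, hj, hp, hpc, hlast⟩ := key hR.2
  have hjl : (j : ℕ∞) < r.len := lt_trans (by exact_mod_cast hj) R.first_lt_len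
  obtain ⟨C, hC⟩ := hr j hjl
  have hl : C.last = j := last_eq_of_mem hC (hp ▸ Or.inr hpc)
  have hCp : r.proc C.first = .homeowner := hC.2.2 ▸ hp
  have hs := r.step j hjl
  rw [hp] at hs
  obtain ⟨hnr, hv⟩ := hs.of_hpc hpc
  subst hl
  rw [removing_iff hCp C.first_le_last le_rfl] at hnr
  have hb := C.begins
  rw [hCp] at hb
  refine ⟨C, ⟨hCp, hb.resolve_right fun h => hnr (Or.inl h)⟩, hv, hj, hlast⟩

theorem removed_eq_delivered {R D : OpExec r} (hR : R.IsRemove) (hD : D.IsDeliver)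
    (h : (r.state R.first).deq = (r.state D.first).enq) :
    ∃ l, D.delivered = some l ∧ R.removed = some l := by
  have hHR := r.hist _ R.last_succ_le
  have hHD := r.hist _ D.last_succ_le
  have hdeq := deq_last_remove hR
  have henq := enq_last hD
  have hrem := hHR.removed (by omega)
  have hdel := hHD.letter (by omega)
  have hle := hHR.deq_le
  rw [hdeq, Nat.add_sub_cancel, h] at hrem
  rw [henq, Nat.add_sub_cancel] at hdel
  have h1 : (r.state D.first).enq < (r.history (R.last + 1)).length := by
    rw [hHR.length]; omega
  have h2 : (r.state D.first).enq < (r.history (D.last + 1)).length := by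
    rw [hHD.length]; omega
  rw [List.getElem?_eq_getElem h1] at hrem
  rw [List.getElem?_eq_getElem h2] at hdel
  refine ⟨_, hdel, hrem.trans (congrArg some ?_)⟩
  -- Either operation may end first; one history is a prefix of the other, so they agree at the
  -- common index.
  rcases le_total (D.last + 1) (R.last + 1) with hle | hle
  · exact ((Run.history_prefix hle).getElem h2).symm
  · exact (Run.history_prefix hle).getElem h1

end OpExec

/-- A strict total order on an infinite type with finite initial segments has the order type of
the natural numbers. -/
theorem nonempty_relIso_nat {E : Type*} [Infinite E] {prec : E → E → Prop}
    [IsStrictTotalOrder E prec] (hfin : ∀ x, {y | prec y x}.Finite) :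
    Nonempty (prec ≃r ((· < ·) : ℕ → ℕ → Prop)) := by
  have hmono : ∀ {x y}, prec x y → {z | prec z x}.ncard < {z | prec z y}.ncard := fun {x y} h =>
    Set.ncard_lt_ncard ⟨fun z hz => trans_of prec hz h, fun hs => irrefl_of prec x (hs h)⟩ (hfin y)
  have hiff : ∀ {x y}, {z | prec z x}.ncard < {z | prec z y}.ncard ↔ prec x y := by
    refine fun {x y} => ⟨fun h => ?_, hmono⟩
    rcases trichotomous_of prec x y with hxy | rfl | hyx
    · exact hxy
    · exact absurd h (lt_irrefl _)
    · exact absurd h (hmono hyx).asymm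
  have hinj : Function.Injective fun x => {z | prec z x}.ncard := by
    intro x y h
    rcases trichotomous_of prec x y with hxy | rfl | hyx
    · exact absurd h (hmono hxy).ne
    · rfl
    · exact absurd h (hmono hyx).ne'
  have hsurj : Function.Surjective fun x => {z | prec z x}.ncard := by
    intro n
    have hwf : WellFounded prec :=
      Subrelation.wf (fun h => hmono h) (measure fun x => {z | prec z x}.ncard).wf
    -- Take `x` minimal of rank at least `n`: its predecessors have distinct ranks below `n`, so its
    -- rank is at most `n`. Such elements exist, since otherwise ranks would inject `E` into `Fin
    -- n`.
    obtain ⟨x, hx, hmin⟩ := hwf.has_min {x | n ≤ {z | prec z x}.ncard} (by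
      by_contra hne
      have hlt : ∀ x, {z | prec z x}.ncard < n := fun x => by
        by_contra hx
        exact hne ⟨x, not_lt.1 hx⟩
      exact not_injective_infinite_finite (fun x => (⟨_, hlt x⟩ : Fin n))
        fun x y h => hinj (Fin.mk.inj_iff.1 h))
    refine ⟨x, le_antisymm ?_ hx⟩
    calc {y | prec y x}.ncard ≤ (Set.Iio n).ncard :=
          Set.ncard_le_ncard_of_injOn (fun y => {z | prec z y}.ncard)
            (fun y hy => Set.mem_Iio.2 (not_le.1 fun h => hmin y h hy)) hinj.injOn (Set.finite_Iio n)
      _ = n := by simp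
  exact ⟨⟨Equiv.ofBijective _ ⟨hinj, hsurj⟩, hiff⟩⟩

end Mailbox

/-! ### The linear mailbox specification -/

theorem mainTheorem1 {L : Type*} (r : Mailbox.Run L) (hr : r.Complete)
    (prec : Mailbox.OpExec r → Mailbox.OpExec r → Prop)
    (hprec : IsStrictTotalOrder (Mailbox.OpExec r) prec)
    (hext : ∀ X Y : Mailbox.OpExec r, X.StarLT Y → prec X Y) :
    Mailbox.LinearMailbox (Mailbox.OpExec.IsDeliver (r := r)) Mailbox.OpExec.IsCheck
      Mailbox.OpExec.IsRemove Mailbox.OpExec.val Mailbox.OpExec.delivered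
      Mailbox.OpExec.removed prec := by
  open Mailbox OpExec in
  have hext' : ∀ X Y : OpExec r, X.Precedes Y → prec X Y := fun X Y h => hext _ _ (Or.inl h)
  refine ⟨fun X => ?_, hprec, ?_, fun R hR => ?_, fun C hC => ⟨fun hv => ?_, fun h => ?_⟩,
    fun i R hR => ?_⟩
  · have hb := X.begins
    simp only [IsDeliver, IsCheck, IsRemove]
    rcases hp : r.proc X.first with _ | _
    · simp
    · rw [hp] at hb
      rcases hb with h | h <;> simp [h]
  · rcases finite_or_infinite (OpExec r) with h | h
    · exact Or.inl h
    · exact Or.inr (nonempty_relIso_nat (finite_prec hext'))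
  · obtain ⟨C, hC, hv, hlt, hlast⟩ := exists_check_last_lt hr hR
    refine ⟨C, hC, hv, hext' _ _ (precedes_iff.2 hlt), ?_⟩
    rintro ⟨X, hX, hCX, hXR⟩
    have hXp : r.proc X.first = .homeowner := by
      rcases hX with h | h <;> exact h.1
    have h1 := (prec_iff hext' (hC.1.trans hXp.symm)).1 hCX
    have h2 := (prec_iff hext' (hXp.trans hR.1.symm)).1 hXR
    -- `X` would begin with a homeowner action in a stretch that contains only postman actions.
    have := hlast _ (last_lt_of_first_lt (hC.1.trans hXp.symm) h1) h2
    rw [hXp] at this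
    cases this
  · exact encard_remove_lt_of_val hr hext hC hv
  · by_contra hv
    exact absurd h (encard_deliver_le_of_val hr hext hC (by simpa using hv)).not_gt
  · have hi := hR.2
    rw [encard_remove_prec hr hext' hR.1.1] at hi
    have hlt := (r.inv _ R.first_lt_len.le).deq_lt_enq hR.1.2
    obtain ⟨D, hD, -, hDn⟩ := exists_deliver_of_lt_enq hr R.first_lt_len.le hlt
    exact ⟨D, ⟨hD, by rw [encard_deliver_prec hr hext' hD, hDn, hi]⟩,
      removed_eq_delivered hR.1 hD hDn.symm⟩
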